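/- Let $F_n$ be the free group on $n\ge 2$ generators. A coset partition of $F_n$ is a family $P=\{H_i\alpha_i\}_{i=1}^{s}$ of pairwise disjoint right cosets with union $F_n$, where each $H_i$ is a subgroup of finite index $d_i$, indexed so that $1<d_1\le\dots\le d_s$. It has multiplicity if $d_i=d_j$ for some $i\ne j$. Let $Y'$ be the set of coset partitions. For $P=\{H_i\alpha_i\}_{i=1}^s$ and $P'=\{K_i\beta_i\}_{i=1}^t$ in $Y'$ put $d(P,P')=0$ if the tuples $(H_s,H_{s-1},\dots,H_1)$ and $(K_t,K_{t-1},\dots,K_1)$ are equal, and $d(P,P')=2^{-m}$ if the $m$-th place is the first place at which they differ. This is a semi-metric; let $Y$ be the metric space obtained from $Y'$ by identifying points at distance $0$, with induced metric $\rho$. For $P=\{H_i\alpha_i\}_{i=1}^s\in Y'$ let $T_i$ be the group of permutations of the set of right cosets of $H_i$ generated by the $n$ permutations $H_ig\mapsto H_iga$, $a$ a free generator. For $w\in F_n$ let $o_{*i}(w)$ be the least $m\ge1$ with $H_i\alpha_iw^m=H_i\alpha_i$, let $o_{\max}(w)=\max_i o_{*i}(w)$, let $k=\max_{w\in F_n}o_{\max}(w)$,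 and let $p$ be the smallest prime dividing $k$. For $u\in F_n$ with $o_{\max}(u)=k$ let $\#=\#(u)$ be the number of $i$ with $o_{*i}(u)=k$. Consider the following conditions on $P$ (an inequality $k>d_{s-j}$ includes the requirement $s-j\ge1$): (C) $T_s$ contains a $d_s$-cycle. (C1) $k>d_{s-2}$. (C2) $k>d_{s-3}$ and $p\ge3$. (C3) $k>d_{s-3}$, $p=2$, and, for some $u$ with $o_{\max}(u)=k$, $\#=2$ or $\#\ge4$. (C4)$_r$ $k>d_{s-r}$ and, for some $u$ with $o_{\max}(u)=k$, at least one of $p\ge r$, $\#=p$, $\#\ge r+1$ holds. Let $P_0=\{H_i\alpha_i\}_{i=1}^{s}$ be a coset partition of $F_n$. Below, $P$ ranges over all coset partitions of $F_n$, and $\rho(P,P_0)$ is the distance in $Y$ of the points that they define. (i) If $P_0$ satisfies (C), then every $P$ with $\rho(P,P_0)<\frac12$ satisfies (C) and has multiplicity. (ii) Let $2\le r\le s-1$. If $P_0$ satisfies (C1), then every $P$ with $\rho(P,P_0)<2^{-(r+1)}$ satisfies (C1) and has multiplicity. If $P_0$ satisfies (C2), then every $P$ with $\rho(P,P_0)<2^{-(r+1)}$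 has multiplicity, and if moreover $r\ge3$, then every such $P$ satisfies (C2). (iii) Let $2\le r\le s-1$. If $P_0$ satisfies (C3) or (C4)$_r$, then every $P$ with $\rho(P,P_0)<2^{-(r+1)}$ has multiplicity. -/

import Mathlib

open MulOpposite
open scoped Pointwise

/-- An element `{H_i α_i}_{1 ≤ i ≤ s}` of `Y'`: a partition of the free group `F_n` on `n` letters
into right cosets of subgroups of finite index, indexed so that `1 < d_1 ≤ … ≤ d_s`, where `d_i` is
the index of `H_i` (in Mathlib a subgroup of infinite index has `index = 0`, so `1 < index` contains
finiteness).  The index `i : Fin s` stands for the position `i + 1`. -/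
structure CosetPartition (n : ℕ) where
  /-- the number of cosets -/
  s : ℕ
  /-- the subgroups -/
  H : Fin s → Subgroup (FreeGroup (Fin n))
  /-- the coset representatives -/
  α : Fin s → FreeGroup (Fin n)
  one_lt_index : ∀ i, 1 < (H i).index
  mono_index : Monotone fun i => (H i).index
  iUnion_coset : ⋃ i, op (α i) • (H i : Set (FreeGroup (Fin n))) = Set.univ
  disjoint_coset : Pairwise fun i j =>
    Disjoint (op (α i) • (H i : Set (FreeGroup (Fin n))))
      (op (α j) • (H j : Set (FreeGroup (Fin n))))

/-- The vertices of the Schreier graph of `H`: the right cosets `Hg`. -/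
abbrev SchreierVertex {n : ℕ} (H : Subgroup (FreeGroup (Fin n))) : Type :=
  Quotient (QuotientGroup.rightRel H)

/-- The permutation `Hg ↦ Hgw` of the vertices of the Schreier graph of `H`. -/
def schreierPerm {n : ℕ} (H : Subgroup (FreeGroup (Fin n))) (w : FreeGroup (Fin n)) :
    Equiv.Perm (SchreierVertex H) where
  toFun := Quotient.map' (fun g => g * w) fun a b h => by
    rw [QuotientGroup.rightRel_apply] at h ⊢
    simpa using h
  invFun := Quotient.map' (fun g => g * w⁻¹) fun a b h => by
    rw [QuotientGroup.rightRel_apply] at h ⊢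
    simpa using h
  left_inv := by
    intro x
    induction x using Quotient.inductionOn' with
    | h g => simp [Quotient.map'_mk'']
  right_inv := by
    intro x
    induction x using Quotient.inductionOn' with
    | h g => simp [Quotient.map'_mk'']

/-- The transition group of the Schreier graph of `H`, generated by the permutations given by the
`n` free generators. -/
def transitionGroup {n : ℕ} (H : Subgroup (FreeGroup (Fin n))) :
    Subgroup (Equiv.Perm (SchreierVertex H)) :=
  Subgroup.closure (Set.range fun a : Fin n => schreierPerm H (FreeGroup.of a))

namespace CosetPartition

variable {n : ℕ}

/-- The index `d_i` of the `i`-th subgroup. -/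
noncomputable def d (P : CosetPartition n) (i : Fin P.s) : ℕ := (P.H i).index

/-- The partition has multiplicity: two of the indices (at different positions) agree. -/
def HasMultiplicity (P : CosetPartition n) : Prop :=
  ∃ i j : Fin P.s, i ≠ j ∧ P.d i = P.d j

/-- The `m`-th place (`1 ≤ m ≤ s`) of the tuple `(H_s, …, H_1)`, that is, `H_{s-m+1}`;
there is nothing (`none`) at the other places. -/
def place (P : CosetPartition n) (m : ℕ) : Option (Subgroup (FreeGroup (Fin n))) :=
  if h : 1 ≤ m ∧ m ≤ P.s then some (P.H ⟨P.s - m, by omega⟩) else none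

/-- The first place at which the tuples of `P` and `Q` differ (used only if there is one). -/
noncomputable def firstDiff (P Q : CosetPartition n) : ℕ :=
  sInf {m : ℕ | P.place m ≠ Q.place m}

open Classical in
/-- `2 ^ (-m)` if `m` is the first place at which the tuples of `P` and `Q` differ, and `0` if the
tuples coincide. -/
noncomputable def semiDist (P Q : CosetPartition n) : ℝ :=
  if P.place = Q.place then 0 else (1 / 2 : ℝ) ^ firstDiff P Q

theorem firstDiff_comm (P Q : CosetPartition n) : firstDiff P Q = firstDiff Q P := by
  simp only [firstDiff, ne_comm]

theorem semiDist_comm (P Q : CosetPartition n) : semiDist P Q = semiDist Q P := by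
  by_cases h : P.place = Q.place
  · rw [semiDist, semiDist, if_pos h, if_pos h.symm]
  · rw [semiDist, semiDist, if_neg h, if_neg (Ne.symm h), firstDiff_comm]

theorem semiDist_nonneg (P Q : CosetPartition n) : 0 ≤ semiDist P Q := by
  unfold semiDist
  split_ifs <;> positivity

theorem firstDiff_spec {P Q : CosetPartition n} (h : P.place ≠ Q.place) :
    P.place (firstDiff P Q) ≠ Q.place (firstDiff P Q) :=
  Nat.sInf_mem (s := {m : ℕ | P.place m ≠ Q.place m}) (Function.ne_iff.mp h)

theorem firstDiff_le {P Q : CosetPartition n} {m : ℕ} (h : P.place m ≠ Q.place m) :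
    firstDiff P Q ≤ m :=
  Nat.sInf_le h

theorem pow_le_semiDist {P Q : CosetPartition n} {m : ℕ} (h : P.place m ≠ Q.place m) :
    (1 / 2 : ℝ) ^ m ≤ semiDist P Q := by
  rw [semiDist, if_neg (fun e => h (congrFun e m))]
  exact pow_le_pow_of_le_one (by norm_num) (by norm_num) (firstDiff_le h)

theorem semiDist_triangle (P Q R : CosetPartition n) :
    semiDist P R ≤ semiDist P Q + semiDist Q R := by
  by_cases h : P.place = R.place
  · rw [semiDist, if_pos h]
    exact add_nonneg (semiDist_nonneg P Q) (semiDist_nonneg Q R)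
  · have h0 := firstDiff_spec h
    rw [semiDist, if_neg h]
    by_cases h1 : P.place (firstDiff P R) = Q.place (firstDiff P R)
    · rw [h1] at h0
      linarith [pow_le_semiDist h0, semiDist_nonneg P Q]
    · linarith [pow_le_semiDist h1, semiDist_nonneg Q R]

/-- The semi-metric on the set `Y'` of coset partitions. -/
noncomputable instance : PseudoMetricSpace (CosetPartition n) where
  dist := semiDist
  dist_self P := by simp [semiDist]
  dist_comm := semiDist_comm
  dist_triangle := semiDist_triangle

/-- There is a `d_s`-cycle in the transition group `T_s` of the Schreier graph of `H_s`. -/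
def HasTopCycle (P : CosetPartition n) : Prop :=
  ∃ i : Fin P.s, (i : ℕ) + 1 = P.s ∧
    ∃ σ ∈ transitionGroup (P.H i), σ.IsCycle ∧ {x | σ x ≠ x}.ncard = P.d i

/-- `o_{*i}(w)`: the least `m ≥ 1` such that `w ^ m` is a loop at the vertex `H_i α_i` of the
Schreier graph of `H_i`. -/
noncomputable def o (P : CosetPartition n) (i : Fin P.s) (w : FreeGroup (Fin n)) : ℕ :=
  Function.minimalPeriod (schreierPerm (P.H i) w) (Quotient.mk'' (P.α i))

/-- `o_max(w)`, the maximum of the `o_{*i}(w)`. -/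
noncomputable def oMax (P : CosetPartition n) (w : FreeGroup (Fin n)) : ℕ :=
  Finset.univ.sup fun i => P.o i w

/-- `k`, the maximum of the `o_max(w)`. -/
noncomputable def k (P : CosetPartition n) : ℕ :=
  sSup (Set.range P.oMax)

/-- `p`, the smallest prime dividing `k`. -/
noncomputable def p (P : CosetPartition n) : ℕ := P.k.minFac

/-- The number `#` of those `i` with `o_{*i}(u) = k`. -/
noncomputable def numMax (P : CosetPartition n) (u : FreeGroup (Fin n)) : ℕ :=
  {i : Fin P.s | P.o i u = P.k}.ncard

/-- `k > d_{s-r}`, where `s - r ≥ 1` (the position `i + 1` is `s - r`). -/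
def ExceedsIndex (P : CosetPartition n) (r : ℕ) : Prop :=
  ∃ i : Fin P.s, (i : ℕ) + 1 + r = P.s ∧ P.d i < P.k

/-- `k > d_{s-2}`. -/
def Cond1 (P : CosetPartition n) : Prop :=
  P.ExceedsIndex 2

/-- `k > d_{s-3}` and `p ≥ 3`. -/
def Cond2 (P : CosetPartition n) : Prop :=
  P.ExceedsIndex 3 ∧ 3 ≤ P.p

/-- `k > d_{s-3}`, `p = 2`, and `# = 2` or `# ≥ 4`, for some `u` with `o_max(u) = k`. -/
def Cond3 (P : CosetPartition n) : Prop :=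
  P.ExceedsIndex 3 ∧ P.p = 2 ∧
    ∃ u, P.oMax u = P.k ∧ (P.numMax u = 2 ∨ 4 ≤ P.numMax u)

/-- `k > d_{s-r}`, and `p ≥ r` or `# = p` or `# ≥ r + 1`, for some `u` with `o_max(u) = k`. -/
def Cond4 (P : CosetPartition n) (r : ℕ) : Prop :=
  P.ExceedsIndex r ∧
    ∃ u, P.oMax u = P.k ∧ (r ≤ P.p ∨ P.numMax u = P.p ∨ r + 1 ≤ P.numMax u)

end CosetPartition

/-- The metric space `Y` of coset partitions of `F_n`: the quotient of `Y'` that identifies points at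
semi-distance zero, with the induced metric `ρ = dist`. -/
abbrev PartitionSpace (n : ℕ) : Type :=
  SeparationQuotient (CosetPartition n)

/-- The point of `Y` given by a coset partition. -/
noncomputable def CosetPartition.toSpace {n : ℕ} (P : CosetPartition n) : PartitionSpace n :=
  SeparationQuotient.mk P

/-! Along an orbit `g * w ^ m`, a coset partition becomes a partition of `ℤ` into arithmetic
progressions, with moduli the periods `o i w`. Let `k > 1` be the largest modulus, attained on the
orbit, and `p` its least prime factor. For `1 ≤ j < p`, sum `ζ ^ (j * m)` over a common period, `ζ`
a primitive `k`-th root of unity. The total and the contribution of each modulus below `k` vanish,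
so a weighted sum of the `j`-th powers of the distinct numbers `ζ ^ r i` vanishes, `r i` running
over the residues of the modulus-`k` progressions. By Vandermonde there are at least `p` of them
(`minFac_le_card_of_progressions`).

If exactly `p` cosets have period `k`, then each orbit through one of them meets all of them, and
counting in a finite quotient makes their indices equal (`d_eq_d_of_ncard_eq`). Periods are bounded
by indices, so `k > d_{s-e}` puts these cosets among the last `e`; hence `p ≤ # ≤ e`, and (C1)–(C4)
each force `# = p` for some `u`. Under (C), `k = d_s`, so all cosets of period `k` have index `d_s`.

The repeated index sits in the last `e` places, which nearby partitions share. Periods depend on the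
representatives only up to conjugating the word, so agreement at `e + 1` places also preserves `k`.
-/

/-! ### Partitions of the integers into arithmetic progressions -/

theorem sum_range_shift_of_periodic {M : Type*} [AddCommGroup M] (f : ℕ → M) (L t : ℕ)
    (hf : ∀ m, f (m + L) = f m) :
    ∑ m ∈ Finset.range L, f (m + t) = ∑ m ∈ Finset.range L, f m := by
  induction t with
  | zero => simp
  | succ t ih =>
    rw [← ih]
    have h1 := Finset.sum_range_succ (fun m => f (m + t)) L
    have h2 := Finset.sum_range_succ' (fun m => f (m + t)) L
    have h3 : f (L + t) = f (0 + t) := by rw [add_comm L t, hf, zero_add]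
    rw [h1, h3] at h2
    have h4 := add_right_cancel h2
    rw [h4]
    exact Finset.sum_congr rfl fun m _ => by congr 1; ring

/-- The sum of the powers of a `k`-th root of unity `z` over a residue class modulo `L`
of a colour whose period `q` satisfies `z ^ q ≠ 1` vanishes. -/
theorem sum_colour_eq_zero {ι : Type*} [DecidableEq ι] (c : ℤ → ι) (o : ι → ℕ)
    (hc : ∀ a m : ℤ, c (a + m) = c a ↔ (o (c a) : ℤ) ∣ m) (L : ℕ)
    (hL : ∀ i, o i ∣ L) (z : ℂ) (hzL : z ^ L = 1) (i : ι) (hz : z ^ o i ≠ 1) :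
    ∑ m ∈ Finset.range L, (if c m = i then z ^ m else 0) = 0 := by
  have hper : ∀ m : ℕ, c ((m + L : ℕ) : ℤ) = c m := fun m => by
    rw [Nat.cast_add, hc]
    exact_mod_cast hL _
  have hsh : ∀ m : ℕ, c ((m + o i : ℕ) : ℤ) = i ↔ c m = i := by
    intro m
    rw [Nat.cast_add]
    constructor
    · intro h
      have h1 := (hc ((m : ℤ) + o i) (-(o i : ℤ))).2 (by rw [h]; simp)
      rw [add_neg_cancel_right] at h1
      rw [h1, h]
    · intro h
      rw [(hc (m : ℤ) (o i)).2 (by rw [h]), h]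
  -- The class of `i` is invariant under translation by `o i`, so its sum equals itself times `z ^ o
  -- i`.
  have h1 := sum_range_shift_of_periodic (fun m : ℕ => if c m = i then z ^ m else 0) L (o i)
    (fun m => by simp only [hper, pow_add, hzL, mul_one])
  simp only [hsh, pow_add] at h1
  have h2 : ∑ m ∈ Finset.range L, (if c m = i then z ^ m * z ^ o i else 0)
      = (∑ m ∈ Finset.range L, (if c m = i then z ^ m else 0)) * z ^ o i := by
    rw [Finset.sum_mul]
    exact Finset.sum_congr rfl fun m _ => by split_ifs <;> simp
  rw [h2] at h1
  have h3 : (∑ m ∈ Finset.range L, (if c m = i then z ^ m else 0)) * (z ^ o i - 1) = 0 := by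
    linear_combination h1
  exact (mul_eq_zero.1 h3).resolve_right (sub_ne_zero.2 hz)

/-- If the weighted power sums of distinct nonzero numbers, with nonzero weights, vanish for the
exponents `1, …, p - 1`, then there are at least `p` numbers, or none. -/
theorem le_card_of_power_sums_eq_zero {ι : Type*} (S : Finset ι) (hS : S.Nonempty)
    (v x : ι → ℂ) (hx : Set.InjOn x S) (hx0 : ∀ i ∈ S, x i ≠ 0) (hv : ∀ i ∈ S, v i ≠ 0) (p : ℕ)
    (h : ∀ j, 1 ≤ j → j < p → ∑ i ∈ S, v i * x i ^ j = 0) : p ≤ S.card := by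
  by_contra! hlt
  let e := S.equivFin.symm
  -- Vandermonde wants exponents from `0`; moving one factor `x` into the weight turns these into
  -- `1, …, S.card`, all below `p`.
  have key := Matrix.eq_zero_of_forall_pow_sum_mul_pow_eq_zero
    (f := fun a => x (e a)) (v := fun a => v (e a) * x (e a))
    (fun a b hab => e.injective (Subtype.ext (hx (e a).2 (e b).2 hab)))
    (fun j => by
      have h1 := h (j + 1) (by omega) (by omega)
      rw [← Finset.sum_coe_sort, ← e.sum_comp] at h1
      rw [← h1]
      exact Finset.sum_congr rfl fun a _ => by ring)
  obtain ⟨i, hi⟩ := hS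
  have := congrFun key (S.equivFin ⟨i, hi⟩)
  simp only [e, Equiv.symm_apply_apply, Pi.zero_apply, mul_eq_zero] at this
  exact this.elim (hv i hi) (hx0 i hi)

/-- In a partition of `ℤ` into finitely many arithmetic progressions the largest modulus `k > 1`
occurs at least as often as the smallest prime factor of `k` says. -/
theorem minFac_le_card_of_progressions {ι : Type*} [Fintype ι] [DecidableEq ι] (c : ℤ → ι)
    (o : ι → ℕ) (hc : ∀ a m : ℤ, c (a + m) = c a ↔ (o (c a) : ℤ) ∣ m) (ho : ∀ i, 0 < o i)
    (k : ℕ) (hk : 1 < k) (hle : ∀ i, o i ≤ k) (a₀ : ℤ) (ha₀ : o (c a₀) = k) :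
    k.minFac ≤ {i | o i = k ∧ ∃ a, c a = i}.ncard := by
  classical
  let L := ∏ i, o i
  have hL : ∀ i, o i ∣ L := fun i => Finset.dvd_prod_of_mem o (Finset.mem_univ i)
  have hL0 : 0 < L := Finset.prod_pos fun i _ => ho i
  have hkL : k ∣ L := ha₀ ▸ hL _
  have hrep : ∀ a : ℤ, ∃ b ∈ Finset.range L, c (b : ℤ) = c a := by
    intro a
    have h0 : 0 ≤ a % (L : ℤ) := Int.emod_nonneg _ (by exact_mod_cast hL0.ne')
    refine ⟨(a % (L : ℤ)).toNat, ?_, ?_⟩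
    · rw [Finset.mem_range]
      have := Int.emod_lt_of_pos a (by exact_mod_cast hL0 : (0 : ℤ) < L)
      omega
    · rw [Int.toNat_of_nonneg h0]
      have h1 : a % (L : ℤ) = a + (L : ℤ) * (-(a / L)) := by
        rw [Int.emod_def]; ring
      rw [h1, hc]
      exact Dvd.dvd.mul_right (by exact_mod_cast hL _) _
  let S : Finset ι := Finset.univ.filter fun i => o i = k ∧ ∃ a, c a = i
  have hSc : {i | o i = k ∧ ∃ a, c a = i}.ncard = S.card := by
    rw [← Set.ncard_coe_finset]; simp [S]
  rw [hSc]
  have hr : ∀ i, ∃ b : ℕ, i ∈ S → b ∈ Finset.range L ∧ c (b : ℤ) = i := by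
    intro i
    by_cases hi : i ∈ S
    · obtain ⟨-, a, ha⟩ := (Finset.mem_filter.1 hi).2
      obtain ⟨b, hb, hb'⟩ := hrep a
      exact ⟨b, fun _ => ⟨hb, hb'.trans ha⟩⟩
    · exact ⟨0, fun h => absurd h hi⟩
  choose r hr using hr
  obtain ⟨ζ, hζ⟩ : ∃ ζ : ℂ, IsPrimitiveRoot ζ k := ⟨_, Complex.isPrimitiveRoot_exp k (by omega)⟩
  have hok : ∀ i ∈ S, o i = k := fun i hi => (Finset.mem_filter.1 hi).2.1
  have hdvd : ∀ i ∈ S, ∀ m : ℕ, c (m : ℤ) = i → (k : ℤ) ∣ (m : ℤ) - r i := by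
    intro i hi m hm
    have h1 := (hc (r i) ((m : ℤ) - r i)).1 (by rw [add_sub_cancel, hm, (hr i hi).2])
    rwa [(hr i hi).2, hok i hi] at h1
  have hpow : ∀ m l : ℕ, (k : ℤ) ∣ (m : ℤ) - l ↔ ζ ^ m = ζ ^ l := by
    intro m l
    have h0 : ζ ≠ 0 := hζ.ne_zero (by omega)
    rw [← hζ.zpow_eq_one_iff_dvd, zpow_sub₀ h0, zpow_natCast, zpow_natCast,
      div_eq_one_iff_eq (pow_ne_zero _ h0)]
  refine le_card_of_power_sums_eq_zero S
    ⟨c a₀, Finset.mem_filter.2 ⟨Finset.mem_univ _, ha₀, a₀, rfl⟩⟩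
    -- The weight counts the `m < L` of colour `i`; only its nonvanishing matters.
    (fun i => (((Finset.range L).filter fun m : ℕ => c m = i).card : ℂ)) (fun i => ζ ^ r i)
    ?_ (fun i _ => pow_ne_zero _ (hζ.ne_zero (by omega))) ?_ _ ?_
  · intro i hi j hj hij
    have h1 := (hc (r j) ((r i : ℤ) - r j)).2
      (by rw [(hr j hj).2, hok j hj]; exact (hpow _ _).2 hij)
    rwa [add_sub_cancel, (hr i hi).2, (hr j hj).2] at h1
  · intro i hi
    rw [Nat.cast_ne_zero]
    exact (Finset.card_pos.2 ⟨r i, Finset.mem_filter.2 (hr i hi)⟩).ne'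
  · intro j hj1 hjp
    -- Below the least prime factor of `k` every exponent is coprime to `k`, so `ζ ^ j` stays
    -- primitive.
    have hcop : j.Coprime k := (Nat.coprime_of_lt_minFac (by omega) hjp).symm
    have hz : IsPrimitiveRoot (ζ ^ j) k := hζ.pow_of_coprime j hcop
    have hzL : (ζ ^ j) ^ L = 1 := (hz.pow_eq_one_iff_dvd L).2 hkL
    have htot : ∑ m ∈ Finset.range L, (ζ ^ j) ^ m = 0 := by
      have h1 := geom_sum_mul (ζ ^ j) L
      rw [hzL, sub_self, mul_eq_zero, sub_eq_zero] at h1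
      exact h1.resolve_right (hz.ne_one hk)
    have hsplit : ∑ m ∈ Finset.range L, (ζ ^ j) ^ m
        = ∑ i, ∑ m ∈ Finset.range L, (if c m = i then (ζ ^ j) ^ m else 0) := by
      rw [Finset.sum_comm]
      exact Finset.sum_congr rfl fun m _ => by simp
    rw [htot] at hsplit
    rw [hsplit]
    refine Finset.sum_subset_zero_on_sdiff (Finset.subset_univ S) ?_ ?_
    · intro i hi
      have hiS : i ∉ S := (Finset.mem_sdiff.1 hi).2
      by_cases hoi : o i = k
      · refine Finset.sum_eq_zero fun m _ => if_neg fun hm => hiS ?_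
        exact Finset.mem_filter.2 ⟨Finset.mem_univ _, hoi, m, hm⟩
      · refine sum_colour_eq_zero c o hc L hL _ hzL i fun h => ?_
        have := Nat.le_of_dvd (ho i) ((hz.pow_eq_one_iff_dvd _).1 h)
        exact hoi (le_antisymm (hle i) this)
    · intro i hi
      rw [← Finset.sum_filter, ← nsmul_eq_mul, ← Finset.sum_const]
      refine Finset.sum_congr rfl fun m hm => ?_
      rw [pow_right_comm ζ j m, (hpow m (r i)).1 (hdvd i hi m (Finset.mem_filter.1 hm).2)]

/-! ### Words acting on right cosets -/

instance finite_schreierVertex {n : ℕ} (H : Subgroup (FreeGroup (Fin n))) [H.FiniteIndex] :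
    Finite (SchreierVertex H) :=
  Finite.of_equiv _ (QuotientGroup.quotientRightRelEquivQuotientLeftRel H).symm

theorem card_schreierVertex {n : ℕ} (H : Subgroup (FreeGroup (Fin n))) :
    Nat.card (SchreierVertex H) = H.index :=
  Nat.card_congr (QuotientGroup.quotientRightRelEquivQuotientLeftRel H)

theorem schreierPerm_iterate {n : ℕ} (H : Subgroup (FreeGroup (Fin n)))
    (w g : FreeGroup (Fin n)) (m : ℕ) :
    (schreierPerm H w)^[m] (Quotient.mk'' g) = Quotient.mk'' (g * w ^ m) := by
  induction m with
  | zero => simp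
  | succ m ih =>
    rw [Function.iterate_succ_apply', ih, pow_succ, ← mul_assoc]
    rfl

theorem schreierPerm_isPeriodicPt {n : ℕ} (H : Subgroup (FreeGroup (Fin n)))
    (w g : FreeGroup (Fin n)) (m : ℕ) :
    Function.IsPeriodicPt (schreierPerm H w) m (Quotient.mk'' g) ↔ g * w ^ m * g⁻¹ ∈ H := by
  rw [Function.IsPeriodicPt, Function.IsFixedPt, schreierPerm_iterate, eq_comm, Quotient.eq'',
    QuotientGroup.rightRel_apply]

/-- Every transition is given by a word. -/
theorem exists_schreierPerm_eq {n : ℕ} (H : Subgroup (FreeGroup (Fin n)))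
    {σ : Equiv.Perm (SchreierVertex H)} (hσ : σ ∈ transitionGroup H) :
    ∃ w, schreierPerm H w = σ := by
  induction hσ using Subgroup.closure_induction with
  | mem x hx =>
    obtain ⟨a, rfl⟩ := hx
    exact ⟨_, rfl⟩
  | one =>
    refine ⟨1, ?_⟩
    ext x
    induction x using Quotient.inductionOn' with
    | h g => simp [schreierPerm, Quotient.map'_mk'']
  | mul x y _ _ hx hy =>
    obtain ⟨v, rfl⟩ := hx
    obtain ⟨w, rfl⟩ := hy
    -- Permutations compose right to left while words act on the right, so the order reverses.
    refine ⟨w * v, ?_⟩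
    ext x
    induction x using Quotient.inductionOn' with
    | h g => simp [schreierPerm, Quotient.map'_mk'', mul_assoc]
  | inv x _ hx =>
    obtain ⟨v, rfl⟩ := hx
    refine ⟨v⁻¹, ?_⟩
    ext x
    induction x using Quotient.inductionOn' with
    | h g => simp [schreierPerm, Quotient.map'_mk'', Equiv.Perm.inv_def]

/-! ### Periods of a word along its orbits -/

namespace CosetPartition

variable {n : ℕ}

theorem finiteIndex (P : CosetPartition n) (i : Fin P.s) : (P.H i).FiniteIndex :=
  ⟨by have := P.one_lt_index i; omega⟩

theorem one_lt_d (P : CosetPartition n) (i : Fin P.s) : 1 < P.d i :=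
  P.one_lt_index i

theorem d_le_d (P : CosetPartition n) {i j : Fin P.s} (h : i ≤ j) : P.d i ≤ P.d j :=
  P.mono_index h

theorem existsUnique_coset (P : CosetPartition n) (g : FreeGroup (Fin n)) :
    ∃! i, g * (P.α i)⁻¹ ∈ P.H i := by
  have h : g ∈ ⋃ i, op (P.α i) • (P.H i : Set (FreeGroup (Fin n))) := by
    rw [P.iUnion_coset]; trivial
  obtain ⟨i, hi⟩ := Set.mem_iUnion.1 h
  refine ⟨i, (mem_rightCoset_iff _).1 hi, fun j hj => ?_⟩
  by_contra hji
  exact Set.disjoint_left.1 (P.disjoint_coset hji) ((mem_rightCoset_iff _).2 hj) hi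

/-- The position of the coset that contains `g`. -/
noncomputable def pos (P : CosetPartition n) (g : FreeGroup (Fin n)) : Fin P.s :=
  (P.existsUnique_coset g).choose

theorem pos_eq_iff (P : CosetPartition n) {g : FreeGroup (Fin n)} {i : Fin P.s} :
    P.pos g = i ↔ g * (P.α i)⁻¹ ∈ P.H i := by
  have h := (P.existsUnique_coset g).choose_spec
  exact ⟨fun e => e ▸ h.1, fun hi => (h.2 i hi).symm⟩

theorem pos_α (P : CosetPartition n) (i : Fin P.s) : P.pos (P.α i) = i := by
  simp [pos_eq_iff]

theorem o_dvd_iff (P : CosetPartition n) (i : Fin P.s) (w : FreeGroup (Fin n)) (m : ℤ) :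
    (P.o i w : ℤ) ∣ m ↔ P.α i * w ^ m * (P.α i)⁻¹ ∈ P.H i := by
  have h (m : ℕ) : P.o i w ∣ m ↔ P.α i * w ^ m * (P.α i)⁻¹ ∈ P.H i := by
    rw [o, ← Function.isPeriodicPt_iff_minimalPeriod_dvd, schreierPerm_isPeriodicPt]
  obtain ⟨m, rfl | rfl⟩ := m.eq_nat_or_neg
  · rw [Int.natCast_dvd_natCast, h, zpow_natCast]
  · rw [dvd_neg, Int.natCast_dvd_natCast, h, zpow_neg, zpow_natCast, ← inv_mem_iff]
    simp [mul_assoc]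

theorem o_pos (P : CosetPartition n) (i : Fin P.s) (w : FreeGroup (Fin n)) : 0 < P.o i w := by
  have := P.finiteIndex i
  exact Function.minimalPeriod_pos_of_mem_periodicPts
    ((schreierPerm (P.H i) w).injective.mem_periodicPts _)

theorem o_le_d (P : CosetPartition n) (i : Fin P.s) (w : FreeGroup (Fin n)) :
    P.o i w ≤ P.d i := by
  have := P.finiteIndex i
  rw [d, ← card_schreierVertex, ← Nat.card_fin (P.o i w)]
  refine Nat.card_le_card_of_injective
    (fun m : Fin (P.o i w) => (schreierPerm (P.H i) w)^[m] (Quotient.mk'' (P.α i))) ?_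
  intro a b hab
  exact Fin.ext (Function.iterate_injOn_Iio_minimalPeriod a.2 b.2 hab)

theorem pos_mul_zpow (P : CosetPartition n) (g w : FreeGroup (Fin n)) (m : ℤ) :
    P.pos (g * w ^ m) = P.pos g ↔ (P.o (P.pos g) w : ℤ) ∣ m := by
  have hg : g * (P.α (P.pos g))⁻¹ ∈ P.H (P.pos g) := P.pos_eq_iff.1 rfl
  rw [pos_eq_iff, o_dvd_iff,
    ← (P.H (P.pos g)).mul_mem_cancel_left (y := P.α (P.pos g) * w ^ m * (P.α (P.pos g))⁻¹) hg]
  simp [mul_assoc]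

/-- At least `minFac K` cosets that meet `g⟨w⟩` have the maximal period `K` under `w`, if one
does. -/
theorem minFac_le_ncard (P : CosetPartition n) (g w : FreeGroup (Fin n)) {K : ℕ} (hK : 1 < K)
    (hle : ∀ i, P.o i w ≤ K) (hg : P.o (P.pos g) w = K) :
    K.minFac ≤ {i | P.o i w = K ∧ ∃ m : ℤ, P.pos (g * w ^ m) = i}.ncard := by
  refine minFac_le_card_of_progressions (fun m : ℤ => P.pos (g * w ^ m)) (fun i => P.o i w)
    (fun a m => ?_) (fun i => P.o_pos i w) K hK hle 0 (by simpa using hg)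
  rw [← pos_mul_zpow, zpow_add, mul_assoc]

theorem minFac_le_ncard_o_eq (P : CosetPartition n) (w : FreeGroup (Fin n)) {K : ℕ} (hK : 1 < K)
    (hle : ∀ i, P.o i w ≤ K) {i : Fin P.s} (hi : P.o i w = K) :
    K.minFac ≤ {i | P.o i w = K}.ncard :=
  (P.minFac_le_ncard (P.α i) w hK hle (by rwa [pos_α])).trans
    (Set.ncard_le_ncard (fun _ h => h.1) (Set.toFinite _))

/-! ### Equality of indices by counting in a finite quotient -/

/-- If every orbit of `w` through the `i`-th coset meets the `j`-th one, and both have the same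
period, then `d_j ≤ d_i`. -/
theorem d_le_d_of_meets (P : CosetPartition n) (w : FreeGroup (Fin n)) (i j : Fin P.s)
    (ho : P.o i w = P.o j w)
    (h : ∀ g, P.pos g = i → ∃ m : ℤ, P.pos (g * w ^ m) = j) : P.d j ≤ P.d i := by
  have := P.finiteIndex
  let F := FreeGroup (Fin n)
  -- Modulo this normal subgroup of finite index, the orders of the images of `H_i` and `H_j` are
  -- inversely proportional to their indices.
  let N : Subgroup F := (P.H i ⊓ P.H j).normalCore
  let π : F →* F ⧸ N := QuotientGroup.mk' N
  have hN : N ≤ P.H i ⊓ P.H j := Subgroup.normalCore_le _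
  have hker : π.ker = N := QuotientGroup.ker_mk' N
  have hπ : Function.Surjective π := QuotientGroup.mk'_surjective N
  have mem (l : Fin P.s) (hl : N ≤ P.H l) (g : F) : π g ∈ (P.H l).map π ↔ g ∈ P.H l := by
    rw [← Subgroup.mem_comap, Subgroup.comap_map_eq_self (by rwa [hker])]
  have card (l : Fin P.s) (hl : N ≤ P.H l) :
      Nat.card ((P.H l).map π) * P.d l = Nat.card (F ⧸ N) := by
    rw [d, ← Subgroup.index_map_eq (P.H l) hπ (by rwa [hker]), Subgroup.card_mul_index]
  have hni := hN.trans inf_le_left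
  have hnj := hN.trans inf_le_right
  have hk0 : (0 : ℤ) < P.o j w := by exact_mod_cast P.o_pos j w
  have hstep (x : (P.H i).map π) : ∃ y : (P.H j).map π, ∃ m : ℤ, 0 ≤ m ∧ m < P.o j w ∧
      (x : F ⧸ N) * π (P.α i) * π w ^ m = y * π (P.α j) := by
    obtain ⟨x, g, hg, rfl⟩ := x
    have hgi : P.pos (g * P.α i) = i := P.pos_eq_iff.2 (by simpa using hg)
    obtain ⟨m, hm⟩ := h _ hgi
    have hm' : P.pos (g * P.α i * w ^ (m % (P.o j w : ℤ))) = j := by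
      have h1 := (P.pos_mul_zpow (g * P.α i * w ^ m) w (-(P.o j w * (m / P.o j w)))).2
        (by rw [hm]; simp)
      rw [mul_assoc, ← zpow_add, ← sub_eq_add_neg, ← Int.emod_def, hm] at h1
      exact h1
    refine ⟨⟨π (g * P.α i * w ^ (m % (P.o j w : ℤ)) * (P.α j)⁻¹),
      (mem j hnj _).2 (P.pos_eq_iff.1 hm')⟩, m % (P.o j w : ℤ), Int.emod_nonneg _ hk0.ne',
      Int.emod_lt_of_pos _ hk0, ?_⟩
    simp only [map_mul, map_inv, map_zpow, inv_mul_cancel_right]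
  choose y m hm0 hmlt hy using hstep
  -- If two points have the same image, a power of `w` with exponent `m a - m b` links them inside
  -- the `i`-th coset. The common period divides this exponent, which is smaller in absolute value,
  -- hence zero.
  have hinj : Function.Injective y := by
    intro a b hab
    obtain ⟨a', ha', hae⟩ := a.2
    obtain ⟨b', hb', hbe⟩ := b.2
    have h1 : (a : F ⧸ N) * π (P.α i) * π w ^ m a = b * π (P.α i) * π w ^ m b := by
      rw [hy, hy, hab]
    have h2 : π (a' * P.α i * w ^ (m a - m b) * (P.α i)⁻¹) = π b' := by
      simp only [map_mul, map_inv, map_zpow, hae, hbe, zpow_sub]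
      rw [← mul_assoc, h1]
      group
    have h3 : a' * P.α i * w ^ (m a - m b) * (P.α i)⁻¹ ∈ P.H i :=
      (mem i hni _).1 (h2 ▸ Subgroup.mem_map_of_mem π hb')
    have h4 : (P.o j w : ℤ) ∣ m a - m b := by
      rw [← ho, o_dvd_iff, ← (P.H i).mul_mem_cancel_left ha']
      simpa only [mul_assoc] using h3
    have h5 : m a = m b := by
      have := Int.eq_zero_of_abs_lt_dvd h4
        (by rw [abs_lt]; have := hm0 a; have := hm0 b; have := hmlt a; have := hmlt b; omega)
      omega
    rw [h5] at h1
    exact Subtype.ext (mul_right_cancel (mul_right_cancel h1))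
  have hle : Nat.card ((P.H i).map π) ≤ Nat.card ((P.H j).map π) :=
    Nat.card_le_card_of_injective y hinj
  have hci := card i hni
  rw [← card j hnj] at hci
  have hpos : 0 < Nat.card ((P.H i).map π) := Nat.card_pos
  by_contra! hlt
  have := Nat.mul_lt_mul_of_le_of_lt hle hlt (hpos.trans_le hle)
  omega

/-- If exactly `minFac K` cosets have the maximal period `K`, then their subgroups have the same
index. -/
theorem d_eq_d_of_ncard_eq (P : CosetPartition n) (w : FreeGroup (Fin n)) {K : ℕ} (hK : 1 < K)
    (hle : ∀ i, P.o i w ≤ K) (hcard : {i | P.o i w = K}.ncard = K.minFac) {i j : Fin P.s}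
    (hi : P.o i w = K) (hj : P.o j w = K) : P.d i = P.d j := by
  have key : ∀ i j : Fin P.s, P.o i w = K → P.o j w = K → P.d j ≤ P.d i := by
    intro i j hi hj
    refine P.d_le_d_of_meets w i j (hi.trans hj.symm) fun g hg => ?_
    have h1 := P.minFac_le_ncard g w hK hle (by rw [hg, hi])
    -- The orbit meets at least `K.minFac` cosets of period `K`, and there are no more than that.
    have h2 : {i | P.o i w = K ∧ ∃ m : ℤ, P.pos (g * w ^ m) = i} = {i | P.o i w = K} :=
      Set.eq_of_subset_of_ncard_le (fun _ h => h.1) (hcard.trans_le h1) (Set.toFinite _)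
    have h3 : j ∈ {i | P.o i w = K} := hj
    rw [← h2] at h3
    exact h3.2
  exact le_antisymm (key j i hj hi) (key i j hi hj)

/-! ### The maximal period and the last positions -/

theorem o_le_oMax (P : CosetPartition n) (i : Fin P.s) (w : FreeGroup (Fin n)) :
    P.o i w ≤ P.oMax w :=
  Finset.le_sup (f := fun i => P.o i w) (Finset.mem_univ i)

theorem bddAbove_oMax (P : CosetPartition n) : BddAbove (Set.range P.oMax) := by
  refine ⟨Finset.univ.sup P.d, ?_⟩
  rintro _ ⟨w, rfl⟩
  exact Finset.sup_mono_fun fun i _ => P.o_le_d i w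

theorem oMax_le_k (P : CosetPartition n) (w : FreeGroup (Fin n)) : P.oMax w ≤ P.k :=
  le_csSup P.bddAbove_oMax ⟨w, rfl⟩

theorem o_le_k (P : CosetPartition n) (i : Fin P.s) (w : FreeGroup (Fin n)) : P.o i w ≤ P.k :=
  (P.o_le_oMax i w).trans (P.oMax_le_k w)

theorem exists_oMax_eq_k (P : CosetPartition n) : ∃ w, P.oMax w = P.k :=
  Nat.sSup_mem (Set.range_nonempty _) P.bddAbove_oMax

theorem exists_o_eq_k (P : CosetPartition n) {u : FreeGroup (Fin n)} (hu : P.oMax u = P.k) :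
    ∃ i, P.o i u = P.k := by
  have : Nonempty (Fin P.s) := ⟨P.pos 1⟩
  obtain ⟨i, -, hi⟩ := Finset.exists_mem_eq_sup Finset.univ Finset.univ_nonempty
    (fun i => P.o i u)
  exact ⟨i, hi.symm.trans hu⟩

theorem ExceedsIndex.one_lt_k {P : CosetPartition n} {e : ℕ} (h : P.ExceedsIndex e) :
    1 < P.k := by
  obtain ⟨i, -, hi⟩ := h
  exact (P.one_lt_d i).trans hi

/-- If `k > d_{s-e}`, then only the last `e` positions can have period `k`. -/
theorem ExceedsIndex.le_of_o_eq_k {P : CosetPartition n} {e : ℕ} (h : P.ExceedsIndex e)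
    {i : Fin P.s} {u : FreeGroup (Fin n)} (hi : P.o i u = P.k) : P.s ≤ i + e := by
  obtain ⟨j, hj, hjk⟩ := h
  by_contra! hlt
  have hij : i ≤ j := Fin.le_def.2 (by omega)
  have := (P.o_le_d i u).trans (P.d_le_d hij)
  omega

theorem ExceedsIndex.numMax_le {P : CosetPartition n} {e : ℕ} (h : P.ExceedsIndex e)
    (u : FreeGroup (Fin n)) : P.numMax u ≤ e := by
  have hes : e ≤ P.s := by
    obtain ⟨i, hi, -⟩ := h
    omega
  rw [numMax, ← Set.ncard_image_of_injective _ Fin.val_injective]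
  calc _ ≤ (Finset.Ico (P.s - e) P.s : Set ℕ).ncard := by
        refine Set.ncard_le_ncard ?_ (Set.toFinite _)
        rintro _ ⟨i, hi, rfl⟩
        have := h.le_of_o_eq_k hi
        have := i.2
        simp only [Finset.coe_Ico, Set.mem_Ico]
        omega
    _ = e := by rw [Set.ncard_coe_finset, Nat.card_Ico]; omega

theorem ExceedsIndex.p_le_numMax {P : CosetPartition n} {e : ℕ} (h : P.ExceedsIndex e)
    {u : FreeGroup (Fin n)} (hu : P.oMax u = P.k) : P.p ≤ P.numMax u := by
  obtain ⟨i, hi⟩ := P.exists_o_eq_k hu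
  exact P.minFac_le_ncard_o_eq u h.one_lt_k (fun i => P.o_le_k i u) hi

/-- Two of the last `e` positions carry the same index. -/
def HasTopMultiplicity (P : CosetPartition n) (e : ℕ) : Prop :=
  ∃ i j : Fin P.s, i ≠ j ∧ P.s ≤ i + e ∧ P.s ≤ j + e ∧ P.d i = P.d j

theorem ExceedsIndex.hasTopMultiplicity {P : CosetPartition n} {e : ℕ} (h : P.ExceedsIndex e)
    {u : FreeGroup (Fin n)} (hnum : P.numMax u = P.p) :
    P.HasTopMultiplicity e := by
  have h2 : 1 < P.numMax u := by
    rw [hnum]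
    exact (Nat.minFac_prime h.one_lt_k.ne').one_lt
  obtain ⟨i, j, hi, hj, hij⟩ := (Set.one_lt_ncard_iff (Set.toFinite _)).1 h2
  exact ⟨i, j, hij, h.le_of_o_eq_k hi, h.le_of_o_eq_k hj,
    P.d_eq_d_of_ncard_eq u h.one_lt_k (fun i => P.o_le_k i u) hnum hi hj⟩

/-- The chain `e ≤ p ≤ # ≤ e` collapses to `# = p`. -/
theorem ExceedsIndex.hasTopMultiplicity_of_le_p {P : CosetPartition n} {e : ℕ}
    (h : P.ExceedsIndex e) (hp : e ≤ P.p) : P.HasTopMultiplicity e := by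
  obtain ⟨u, hu⟩ := P.exists_oMax_eq_k
  have h1 := h.p_le_numMax hu
  have h2 := h.numMax_le u
  exact h.hasTopMultiplicity (u := u) (by omega)

theorem Cond1.hasTopMultiplicity {P : CosetPartition n} (h : P.Cond1) :
    P.HasTopMultiplicity 2 :=
  ExceedsIndex.hasTopMultiplicity_of_le_p h
    (Nat.minFac_prime (ExceedsIndex.one_lt_k h).ne').two_le

theorem Cond2.hasTopMultiplicity {P : CosetPartition n} (h : P.Cond2) :
    P.HasTopMultiplicity 3 :=
  h.1.hasTopMultiplicity_of_le_p h.2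

/-- Only three positions can have period `k`, so `# ≥ 4` never happens and `# = 2 = p` remains. -/
theorem Cond3.hasTopMultiplicity {P : CosetPartition n} (h : P.Cond3) :
    P.HasTopMultiplicity 3 := by
  obtain ⟨h, hp, u, -, hnum⟩ := h
  have := h.numMax_le u
  exact h.hasTopMultiplicity (u := u) (by omega)

/-- The alternative `# ≥ r + 1` is vacuous because `# ≤ r`. -/
theorem Cond4.hasTopMultiplicity {P : CosetPartition n} {r : ℕ} (h : P.Cond4 r) :
    P.HasTopMultiplicity r := by
  obtain ⟨h, u, -, hp | hnum | hnum⟩ := h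
  · exact h.hasTopMultiplicity_of_le_p hp
  · exact h.hasTopMultiplicity hnum
  · have := h.numMax_le u
    omega

/-! ### Transfer to nearby partitions -/

/-- The places at which two partitions agree by their distance. -/
theorem place_eq_of_dist_lt {P Q : CosetPartition n} {m : ℕ}
    (h : dist P.toSpace Q.toSpace < (1 / 2 : ℝ) ^ m) {l : ℕ} (hl : l ≤ m) :
    P.place l = Q.place l := by
  by_contra hne
  have h1 : (1 / 2 : ℝ) ^ l ≤ dist P.toSpace Q.toSpace := by
    rw [toSpace, toSpace, SeparationQuotient.dist_mk]
    exact pow_le_semiDist hne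
  have h2 : (1 / 2 : ℝ) ^ m ≤ (1 / 2 : ℝ) ^ l :=
    pow_le_pow_of_le_one (by norm_num) (by norm_num) hl
  linarith

/-- Agreement at a place in terms of positions counted from the end. -/
theorem exists_H_eq_of_place_eq {P Q : CosetPartition n} {i : Fin P.s}
    (h : P.place (P.s - i) = Q.place (P.s - i)) :
    ∃ j : Fin Q.s, (j : ℕ) + P.s = i + Q.s ∧ Q.H j = P.H i := by
  have hi := i.2
  have hP : P.place (P.s - i) = some (P.H i) := by
    rw [place, dif_pos (by omega)]
    congr 2
    exact Fin.ext (by simp only; omega)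
  rw [hP, place] at h
  split_ifs at h with hQ
  exact ⟨_, by simp only; omega, (Option.some.inj h).symm⟩

theorem HasTopMultiplicity.hasMultiplicity_of_place_eq {P Q : CosetPartition n} {e : ℕ}
    (h : P.HasTopMultiplicity e) (hPQ : ∀ l ≤ e, P.place l = Q.place l) :
    Q.HasMultiplicity := by
  obtain ⟨i, j, hij, hi, hj, hd⟩ := h
  obtain ⟨i', hi', hHi⟩ := exists_H_eq_of_place_eq (hPQ (P.s - i) (by omega))
  obtain ⟨j', hj', hHj⟩ := exists_H_eq_of_place_eq (hPQ (P.s - j) (by omega))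
  refine ⟨i', j', fun he => hij (Fin.ext ?_), ?_⟩
  · subst he; omega
  · rw [d, d, hHi, hHj]; exact hd

/-- The period of a coset of `H` depends on the representative only up to conjugation of the
word. -/
theorem exists_o_eq_of_H_eq {P Q : CosetPartition n} {i : Fin P.s} {j : Fin Q.s}
    (h : Q.H j = P.H i) (w : FreeGroup (Fin n)) : ∃ v, Q.o j v = P.o i w := by
  let x := (Q.α j)⁻¹ * P.α i
  refine ⟨x * w * x⁻¹, Nat.dvd_antisymm ?_ ?_⟩ <;>
  rw [← Int.natCast_dvd_natCast, o_dvd_iff]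
  · have h1 := (P.o_dvd_iff i w (P.o i w)).1 dvd_rfl
    rw [conj_zpow, h]
    simpa [x, mul_assoc] using h1
  · have h1 := (Q.o_dvd_iff j (x * w * x⁻¹) (Q.o j (x * w * x⁻¹))).1 dvd_rfl
    rw [conj_zpow, h] at h1
    simpa [x, mul_assoc] using h1

/-- The period `k` of `P` is attained in the last `e` positions, and a conjugate word attains it in
`Q`. Place `e + 1` carries the subgroup of index `d_{s-e}`, needed for the inequality itself. -/
theorem ExceedsIndex.k_le_and_exceedsIndex {P Q : CosetPartition n} {e : ℕ}
    (h : P.ExceedsIndex e) (hPQ : ∀ l ≤ e + 1, P.place l = Q.place l) :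
    P.k ≤ Q.k ∧ Q.ExceedsIndex e := by
  have hk : P.k ≤ Q.k := by
    obtain ⟨u, hu⟩ := P.exists_oMax_eq_k
    obtain ⟨i, hi⟩ := P.exists_o_eq_k hu
    have hie := h.le_of_o_eq_k hi
    obtain ⟨j, -, hj⟩ := exists_H_eq_of_place_eq (hPQ (P.s - i) (by omega))
    obtain ⟨v, hv⟩ := exists_o_eq_of_H_eq hj u
    exact hi ▸ hv ▸ Q.o_le_k j v
  refine ⟨hk, ?_⟩
  obtain ⟨i, hi, hik⟩ := h
  obtain ⟨j, hj, hH⟩ := exists_H_eq_of_place_eq (hPQ (P.s - i) (by omega))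
  refine ⟨j, by omega, ?_⟩
  rw [d, hH]
  exact hik.trans_le hk

/-- Since `Q` inherits the inequality, the comparison of maximal periods can be run in both
directions. -/
theorem ExceedsIndex.k_eq {P Q : CosetPartition n} {e : ℕ}
    (h : P.ExceedsIndex e) (hPQ : ∀ l ≤ e + 1, P.place l = Q.place l) : P.k = Q.k := by
  obtain ⟨h1, h2⟩ := h.k_le_and_exceedsIndex hPQ
  exact le_antisymm h1 (h2.k_le_and_exceedsIndex fun l hl => (hPQ l hl).symm).1

theorem HasTopCycle.of_place_eq {P Q : CosetPartition n} (h : P.HasTopCycle)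
    (hPQ : ∀ l ≤ 1, P.place l = Q.place l) : Q.HasTopCycle := by
  obtain ⟨i, hi, hσ⟩ := h
  obtain ⟨j, hj, hH⟩ := exists_H_eq_of_place_eq (hPQ (P.s - i) (by omega))
  refine ⟨j, by omega, ?_⟩
  rw [d, hH]
  exact hσ

theorem HasTopCycle.hasMultiplicity {P : CosetPartition n} (h : P.HasTopCycle) :
    P.HasMultiplicity := by
  classical
  obtain ⟨i, hi, σ, hσ, hcyc, hcard⟩ := h
  obtain ⟨w, rfl⟩ := exists_schreierPerm_eq _ hσ
  have := P.finiteIndex i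
  have := Fintype.ofFinite (SchreierVertex (P.H i))
  have hord : orderOf (schreierPerm (P.H i) w) = P.d i := by
    rw [hcyc.orderOf, ← hcard, ← Set.ncard_coe_finset]
    congr 1
    ext x
    simp
  -- The cycle moves `d_s` points and there are only `d_s` vertices, so it passes through `H_s α_s`.
  have hmove : schreierPerm (P.H i) w (Quotient.mk'' (P.α i)) ≠ Quotient.mk'' (P.α i) := by
    have huniv : {x | schreierPerm (P.H i) w x ≠ x} = Set.univ := by
      rw [Set.eq_univ_iff_ncard, hcard, card_schreierVertex, d]
    exact huniv.ge (Set.mem_univ (Quotient.mk'' (P.α i)))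
  have hoi : P.o i w = P.d i := by
    refine le_antisymm (P.o_le_d i w) ?_
    rw [← hord]
    refine orderOf_le_of_pow_eq_one (P.o_pos i w) (hcyc.pow_eq_one_iff.2 ⟨_, hmove, ?_⟩)
    rw [Equiv.Perm.coe_pow]
    exact Function.isPeriodicPt_minimalPeriod _ _
  have hle (j : Fin P.s) : P.d j ≤ P.d i := P.d_le_d (Fin.le_def.2 (by omega))
  have hnum := P.minFac_le_ncard_o_eq w (P.one_lt_d i)
    (fun j => (P.o_le_d j w).trans (hle j)) hoi
  have h2 : 1 < {j | P.o j w = P.d i}.ncard :=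
    (Nat.minFac_prime (P.one_lt_d i).ne').one_lt.trans_le hnum
  obtain ⟨a, b, ha, hb, hab⟩ := (Set.one_lt_ncard_iff (Set.toFinite _)).1 h2
  -- A coset of period `d_s` has index at least `d_s`, which is the largest index.
  have hd (j : Fin P.s) (hj : P.o j w = P.d i) : P.d j = P.d i :=
    le_antisymm (hle j) (hj ▸ P.o_le_d j w)
  exact ⟨a, b, hab, (hd a ha).trans (hd b hb).symm⟩

end CosetPartition

theorem theoremB (n : ℕ) (hn : 2 ≤ n) (P₀ : CosetPartition n) :
    (P₀.HasTopCycle → ∀ P : CosetPartition n, dist P.toSpace P₀.toSpace < 1 / 2 →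
      P.HasTopCycle ∧ P.HasMultiplicity) ∧
    ∀ r : ℕ, 2 ≤ r → r < P₀.s →
      (P₀.Cond1 → ∀ P : CosetPartition n, dist P.toSpace P₀.toSpace < (1 / 2 : ℝ) ^ (r + 1) →
        P.Cond1 ∧ P.HasMultiplicity) ∧
      (P₀.Cond2 → ∀ P : CosetPartition n, dist P.toSpace P₀.toSpace < (1 / 2 : ℝ) ^ (r + 1) →
        (3 ≤ r → P.Cond2) ∧ P.HasMultiplicity) ∧
      (P₀.Cond3 ∨ P₀.Cond4 r →
        ∀ P : CosetPartition n, dist P.toSpace P₀.toSpace < (1 / 2 : ℝ) ^ (r + 1) →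
          P.HasMultiplicity) := by
  have agree {P : CosetPartition n} {m e : ℕ}
      (h : dist P.toSpace P₀.toSpace < (1 / 2 : ℝ) ^ m) (he : e ≤ m) :
      ∀ l ≤ e, P₀.place l = P.place l :=
    fun l hl => (CosetPartition.place_eq_of_dist_lt h (hl.trans he)).symm
  refine ⟨fun hC P hP => ?_, fun r hr _ => ⟨fun hC P hP => ?_, fun hC P hP => ?_,
    fun hC P hP => ?_⟩⟩
  · rw [← pow_one (1 / 2 : ℝ)] at hP
    have hC' := hC.of_place_eq (agree hP le_rfl)
    exact ⟨hC', hC'.hasMultiplicity⟩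
  · exact ⟨(CosetPartition.ExceedsIndex.k_le_and_exceedsIndex hC (agree hP (by omega))).2,
      hC.hasTopMultiplicity.hasMultiplicity_of_place_eq (agree hP (by omega))⟩
  -- Multiplicity uses three common places, available as `r + 1 ≥ 3`; keeping (C2) uses a fourth,
  -- hence `r ≥ 3`.
  · refine ⟨fun hr3 => ⟨(hC.1.k_le_and_exceedsIndex (agree hP (by omega))).2, ?_⟩,
      hC.hasTopMultiplicity.hasMultiplicity_of_place_eq (agree hP (by omega))⟩
    rw [CosetPartition.p, ← hC.1.k_eq (agree hP (by omega))]
    exact hC.2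
  · rcases hC with hC | hC
    · exact hC.hasTopMultiplicity.hasMultiplicity_of_place_eq (agree hP (by omega))
    · exact hC.hasTopMultiplicity.hasMultiplicity_of_place_eq (agree hP (by omega))
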